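/- **Spirals.** For $n\ge 1$ let $S_n=(\{l\}\times \mathbb Z/n!)\cup(\{m\}\times\{-n+1,\dots,n-1\})\cup(\{r\}\times\mathbb Z/n!)$ (representing residues by $0,\dots,n!-1$), with the relation: $(l,k)R_n(l,k+1)$ and $(r,k)R_n(r,k+1)$ for $k\in\mathbb Z/n!$; $(m,k)R_n(m,k+1)$ for $-n+1\le k<n-1$; $(l,-n \bmod n!)\,R_n\,(m,-n+1)$; $(m,n-1)\,R_n\,(r,n\bmod n!)$. Define $\xi_L,\xi_G,\xi_M:S_{n+1}\to S_n$ by $\xi_L(a,k)=(l,k \bmod n!)$, $\xi_G(a,k)=(r,k\bmod n!)$, $\xi_M(a,k)=(a,k\bmod n!)$ for $a\in\{l,r\}$, $\xi_M(m,k)=(m,k)$ for $|k|\le n-1$, $\xi_M(m,-n)=(l,-n\bmod n!)$, $\xi_M(m,n)=(r,n\bmod n!)$. Let $W_n$ be the disjoint union of $6^n$ copies of $S_n$ indexed by the words of length $n$ in the letters $\xi_{L_1},\xi_{L_2},\xi_{M_1},\xi_{M_2},\xi_{G_1},\xi_{G_2}$, with the discrete topology and the union $R_n$ of the relations of the copies;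 put $f(n)=|W_n|=6^n(2\,n!+2n-1)$. The map $\xi:W_{n+1}\to W_n$ deletes the last letter of the word and applies $\xi_L$, $\xi_M$ or $\xi_G$ to the point, according to that letter; composing gives $\xi:W_{n+k}\to W_n$. **Systems.** Let $X$ be a compact Hausdorff space and $S:X\to X$ a homeomorphism. Write $\phi:(X,S)\to(W_n,R_n)$ if $\phi:X\to W_n$ is a continuous surjection and $\phi(x)R_n\phi(S x)$ for all $x$. For a map $\phi$ on $X$ let $A_\phi$ be the partition of $X$ into the fibres of $\phi$. $(X,S)$ has the *lifting property* if for every $n\ge1$, every $\phi:(X,S)\to(W_n,R_n)$ and every partition $A$ of $X$ into non-empty clopen sets refining $A_\phi$ there are $k\ge1$ and $\psi:(X,S)\to(W_{n+k},R_{n+k})$ such that $A_\psi$ refines $A$ and $\phi=\xi\circ\psi$. If $X$ is a metric space, $(X,S)$ has the *metric lifting property* if for every $n\ge1$, $\varepsilon>0$ and $\phi:(X,S)\to(W_n,R_n)$ there are $k\ge1$ and $\psi:(X,S)\to(W_{n+k},R_{n+k})$ such that all members of $A_\psi$ have diameter less than $\varepsilon$ and $\phi=\xi\circ\psi$. **Logic.**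 Formulas are those of continuous logic in the language of unital C*-algebras with an additional unary function symbol for an automorphism: atomic formulas are norms of terms, connectives are continuous functions $\mathbb R^j\to\mathbb R$, and quantifiers are $\sup$ and $\inf$ over closed balls of integer radius centred at $0$. The models of $T_{Cantor-A}$ are the structures $(C(X),\sigma)$, where $X$ is a compact zero-dimensional Hausdorff space without isolated points and $\sigma(g)=g\circ S$ for a homeomorphism $S$ of $X$. A set $\Sigma$ of formulas in a fixed finite tuple of variables is realized by a tuple $\bar a$ in a model if $\psi(\bar a)=0$ for all $\psi\in\Sigma$; it is a type if it is realized in some model of $T_{Cantor-A}$; a model omits it if no tuple of the model realizes it. **Theorem.** There are formulas $\psi_{n,m,k}(\bar x,\bar y)$, with $\bar x=(x_w)_{w\in W_n}$ and $\bar y=(y_1,\dots,y_m)$, such that, with $$\Sigma_{n,m}=\{\psi_{n,m,k} : k\ge1,\ m<f(n+k)\}\qquad(n\ge1,\ m>f(n)),$$ the following hold. 1. Let $n,k\ge1$ and $f(n)<m<f(n+k)$. In every model $(C(X),\sigma)$ of $T_{Cantor-A}$, with $\sigma$ induced by $S$, a tuple $(\bar x,\bar y)$ satisfies $\psi_{n,m,k}(\bar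 x,\bar y)=0$ if and only if there are $\alpha:(X,S)\to(W_n,R_n)$ and a continuous surjection $q:X\to\{1,\dots,m\}$ such that $x_w$ is the indicator function of $\alpha^{-1}(w)$ for all $w \in W_n$, $y_j$ is the indicator function of $q^{-1}(j)$ for all $j$, $A_q$ refines $A_\alpha$, and there is no $\beta:(X,S)\to(W_{n+k},R_{n+k})$ such that $A_\beta$ refines $A_q$ and $\alpha=\xi\circ\beta$. 2. Each $\Sigma_{n,m}$ is a type. 3. A model $(C(X),\sigma)$ of $T_{Cantor-A}$, with $\sigma$ induced by $S$, omits every $\Sigma_{n,m}$ if and only if $(X,S)$ has the lifting property. 4. If moreover $X$ is a metric space, then $(C(X),\sigma)$ omits every $\Sigma_{n,m}$ if and only if $(X,S)$ has the metric lifting property. -/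

import Mathlib

namespace CantorLifting

/-! ## Continuous logic for unital C*-algebras with an automorphism -/

/-- Terms of the language of unital C*-algebras with one additional unary function symbol
`aut` for an automorphism; the variables are indexed by `α`. -/
inductive CTerm (α : Type) : Type
  | var (a : α) : CTerm α
  | zero : CTerm α
  | one : CTerm α
  | smul (c : ℂ) (t : CTerm α) : CTerm α
  | add (s t : CTerm α) : CTerm α
  | mul (s t : CTerm α) : CTerm α
  | adj (t : CTerm α) : CTerm α
  | aut (t : CTerm α) : CTerm α

/-- The value of a term in the structure `(A, σ)`. -/
def CTerm.eval {α : Type} {A : Type*} [CStarAlgebra A] (σ : A ≃⋆ₐ[ℂ] A) (v : α → A) :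
    CTerm α → A
  | .var a => v a
  | .zero => 0
  | .one => 1
  | .smul c t => c • t.eval σ v
  | .add s t => s.eval σ v + t.eval σ v
  | .mul s t => s.eval σ v * t.eval σ v
  | .adj t => star (t.eval σ v)
  | .aut t => σ (t.eval σ v)

/-- Formulas of continuous logic whose free variables are indexed by `α` together with `n`
further variables that are waiting to be bound.  Atomic formulas are norms of terms, the
connectives are all continuous functions `ℝ ^ j → ℝ`, and the quantifiers are suprema and infima
over the closed balls of integer radius centred at `0` (the domains of quantification). -/
inductive BdFormula (α : Type) : ℕ → Type
  | norm {n : ℕ} (t : CTerm (α ⊕ Fin n)) : BdFormula α n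
  | conn {n : ℕ} (j : ℕ) (u : C(Fin j → ℝ, ℝ)) (φ : Fin j → BdFormula α n) : BdFormula α n
  | sup {n : ℕ} (R : ℕ) (φ : BdFormula α (n + 1)) : BdFormula α n
  | inf {n : ℕ} (R : ℕ) (φ : BdFormula α (n + 1)) : BdFormula α n

/-- The real value of a formula in the structure `(A, σ)`. -/
noncomputable def BdFormula.value {α : Type} {A : Type*} [CStarAlgebra A] (σ : A ≃⋆ₐ[ℂ] A)
    (v : α → A) : {n : ℕ} → BdFormula α n → (Fin n → A) → ℝ
  | _, .norm t, w => ‖t.eval σ (Sum.elim v w)‖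
  | _, .conn _ u φ, w => u fun i => (φ i).value σ v w
  | _, .sup R φ, w => ⨆ b : {b : A // ‖b‖ ≤ R}, φ.value σ v (Fin.snoc w b.1)
  | _, .inf R φ, w => ⨅ b : {b : A // ‖b‖ ≤ R}, φ.value σ v (Fin.snoc w b.1)

/-- Formulas with free variables indexed by `α`. -/
abbrev Formula (α : Type) : Type := BdFormula α 0

/-- The tuple `a` satisfies the condition `ψ = 0` in `(A, σ)`. -/
def Formula.Holds {α : Type} {A : Type*} [CStarAlgebra A] (σ : A ≃⋆ₐ[ℂ] A) (ψ : Formula α)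
    (a : α → A) : Prop :=
  BdFormula.value σ a ψ Fin.elim0 = 0

/-- The automorphism `f ↦ f ∘ S` of `C(X)` induced by a homeomorphism `S` of `X`. -/
noncomputable def dualAut {X : Type*} [TopologicalSpace X] [CompactSpace X] (S : X ≃ₜ X) :
    C(X, ℂ) ≃⋆ₐ[ℂ] C(X, ℂ) :=
  S.compStarAlgEquiv' ℂ ℂ

/-- The tuple `a` of elements of `C(X)` satisfies all the conditions `ψ = 0`, `ψ ∈ Γ`, in the
structure `(C(X), S)`. -/
def Realizes {X : Type*} [TopologicalSpace X] [CompactSpace X] (S : X ≃ₜ X) {α : Type}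
    (Γ : Set (Formula α)) (a : α → C(X, ℂ)) : Prop :=
  ∀ ψ ∈ Γ, Formula.Holds (dualAut S) ψ a

/-- The structure `(C(X), S)` omits `Γ`. -/
def Omits {X : Type*} [TopologicalSpace X] [CompactSpace X] (S : X ≃ₜ X) {α : Type}
    (Γ : Set (Formula α)) : Prop :=
  ¬ ∃ a : α → C(X, ℂ), Realizes S Γ a

/-- `Γ` is a (partial) type of the theory of the structures `(C(X), S)`, where `X` is a compact
zero-dimensional Hausdorff space without isolated points and `S` is a homeomorphism of `X`:
it is realized in a model of that theory. -/
def IsTypeOfCantorA {α : Type} (Γ : Set (Formula α)) : Prop :=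
  ∃ (X : Type) (_ : TopologicalSpace X) (_ : CompactSpace X) (_ : T2Space X)
    (_ : TotallyDisconnectedSpace X) (_ : PerfectSpace X) (S : X ≃ₜ X) (a : α → C(X, ℂ)),
    Realizes S Γ a

/-! ## Spirals -/

/-- The underlying set of the `n`-spiral: two cycles of length `n!` and a segment with
`2 n - 1` points. -/
inductive Spiral (n : ℕ) : Type
  | l (k : ZMod n.factorial) : Spiral n
  | m (k : Set.Icc (-(n : ℤ) + 1) ((n : ℤ) - 1)) : Spiral n
  | r (k : ZMod n.factorial) : Spiral n

/-- The relation of the `n`-spiral. The segment leaves the left cycle at the residue of `-n`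
and enters the right cycle at the residue of `n`. -/
inductive Spiral.Rel (n : ℕ) : Spiral n → Spiral n → Prop
  | left (k : ZMod n.factorial) : Rel n (.l k) (.l (k + 1))
  | right (k : ZMod n.factorial) : Rel n (.r k) (.r (k + 1))
  | mid (k k' : Set.Icc (-(n : ℤ) + 1) ((n : ℤ) - 1)) (h : k'.1 = k.1 + 1) :
      Rel n (.m k) (.m k')
  | leave (k : Set.Icc (-(n : ℤ) + 1) ((n : ℤ) - 1)) (h : k.1 = -(n : ℤ) + 1) :
      Rel n (.l ((-(n : ℤ) : ℤ) : ZMod n.factorial)) (.m k)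
  | enter (k : Set.Icc (-(n : ℤ) + 1) ((n : ℤ) - 1)) (h : k.1 = (n : ℤ) - 1) :
      Rel n (.m k) (.r ((n : ℤ) : ZMod n.factorial))

/-- The integer coordinate of a point of a spiral; it lies in `{0, …, n! - 1}` on the cycles. -/
def Spiral.coord {n : ℕ} : Spiral n → ℤ
  | .l k => (k.val : ℤ)
  | .m k => k.1
  | .r k => (k.val : ℤ)

/-- Wrap everything around the left cycle. -/
def Spiral.xiL (n : ℕ) (x : Spiral (n + 1)) : Spiral n := .l (x.coord : ZMod n.factorial)

/-- Wrap everything around the right cycle. -/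
def Spiral.xiG (n : ℕ) (x : Spiral (n + 1)) : Spiral n := .r (x.coord : ZMod n.factorial)

/-- Project straight down; the two end points of the longer segment go to the cycles. -/
noncomputable def Spiral.xiM (n : ℕ) : Spiral (n + 1) → Spiral n
  | .l k => .l ((k.val : ℤ) : ZMod n.factorial)
  | .r k => .r ((k.val : ℤ) : ZMod n.factorial)
  | .m k =>
      if h : k.1 ∈ Set.Icc (-(n : ℤ) + 1) ((n : ℤ) - 1) then .m ⟨k.1, h⟩
      else if k.1 < 0 then .l (k.1 : ZMod n.factorial)
      else .r (k.1 : ZMod n.factorial)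

/-- The three kinds of letters. -/
inductive Kind : Type
  | L | M | G

/-- The six letters: two of each kind. -/
abbrev Letter : Type := Kind × Fin 2

/-- `W n`: the disjoint union of `6 ^ n` copies of the `n`-spiral, indexed by the words of
length `n` in the six letters. -/
@[ext]
structure W (n : ℕ) : Type where
  word : Fin n → Letter
  pt : Spiral n

/-- `W n` carries the discrete topology. -/
instance (n : ℕ) : TopologicalSpace (W n) := ⊥

instance (n : ℕ) : DiscreteTopology (W n) := ⟨rfl⟩

/-- The relation `R_n` on `W n`: the union of the relations of the copies of the spiral. -/
def W.Rel (n : ℕ) (x y : W n) : Prop := x.word = y.word ∧ Spiral.Rel n x.pt y.pt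

/-- The map `W (n + 1) → W n`: the last letter of the word selects the map between spirals and
is then deleted. -/
noncomputable def xiStep (n : ℕ) (x : W (n + 1)) : W n where
  word := Fin.init x.word
  pt := match (x.word (Fin.last n)).1 with
    | .L => Spiral.xiL n x.pt
    | .M => Spiral.xiM n x.pt
    | .G => Spiral.xiG n x.pt

/-- The canonical map `W (n + k) → W n`. -/
noncomputable def xi (n : ℕ) : (k : ℕ) → W (n + k) → W n
  | 0 => id
  | k + 1 => fun x => xi n k (xiStep (n + k) x)

/-- The number `f n` of points of `W n` (for `n ≥ 1`). -/
def f (n : ℕ) : ℕ := 6 ^ n * (2 * n.factorial + 2 * n - 1)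

/-! ## Maps onto spirals, partitions, and the lifting property -/

/-- `φ : (X, S) → (W n, R_n)`: a continuous surjection with `φ x R_n φ (S x)` for all `x`. -/
structure IsSpiralMap {X : Type*} [TopologicalSpace X] (S : X ≃ₜ X) (n : ℕ) (φ : X → W n) :
    Prop where
  continuous : Continuous φ
  surjective : Function.Surjective φ
  rel : ∀ x, W.Rel n (φ x) (φ (S x))

/-- The partition `A_φ` of `X` into the fibres of `φ`. -/
def fiberPartition {X Y : Type*} (φ : X → Y) : Set (Set X) :=
  Set.range fun y => φ ⁻¹' {y}

/-- The partition `A` refines the partition `B`. -/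
def Refines {X : Type*} (A B : Set (Set X)) : Prop := ∀ U ∈ A, ∃ V ∈ B, U ⊆ V

/-- A partition of `X` into non-empty clopen sets (a finite one when `X` is compact). -/
def IsClopenPartition {X : Type*} [TopologicalSpace X] (A : Set (Set X)) : Prop :=
  Setoid.IsPartition A ∧ ∀ U ∈ A, IsClopen U

/-- The lifting property of a system on a compact metric space. -/
def HasMetricLiftingProperty {X : Type*} [MetricSpace X] (S : X ≃ₜ X) : Prop :=
  ∀ ε : ℝ, 0 < ε → ∀ n : ℕ, 1 ≤ n → ∀ φ : X → W n, IsSpiralMap S n φ →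
    ∃ k : ℕ, 1 ≤ k ∧ ∃ ψ : X → W (n + k), IsSpiralMap S (n + k) ψ ∧
      (∀ U ∈ fiberPartition ψ, Metric.diam U < ε) ∧ φ = xi n k ∘ ψ

/-- The lifting property in topological terms, for systems on arbitrary compact spaces. -/
def HasLiftingProperty {X : Type*} [TopologicalSpace X] (S : X ≃ₜ X) : Prop :=
  ∀ n : ℕ, 1 ≤ n → ∀ φ : X → W n, IsSpiralMap S n φ →
    ∀ A : Set (Set X), IsClopenPartition A → Refines A (fiberPartition φ) →
      ∃ k : ℕ, 1 ≤ k ∧ ∃ ψ : X → W (n + k), IsSpiralMap S (n + k) ψ ∧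
        Refines (fiberPartition ψ) A ∧ φ = xi n k ∘ ψ

/-- `x` is the tuple of the projections in `C(X)` that are the indicator functions of the
fibres of `φ`. -/
def IsFiberProjections {X ι : Type*} [TopologicalSpace X] (φ : X → ι) (x : ι → C(X, ℂ)) : Prop :=
  ∀ i p, x i p = Set.indicator (φ ⁻¹' {i}) (fun _ => (1 : ℂ)) p

/-- The property of a tuple `(x, y)` in `C(X)` that is expressed by the formula `ψ_{n,m,k}`:
`x` encodes a map `α : (X, S) → (W n, R_n)`, `y` encodes a refinement of `A_α` with `m` pieces
(the fibres of `q`), and no map `β : (X, S) → (W (n + k), R_{n+k})` with `α = ξ ∘ β` has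
`A_β` refining it. -/
def IsUnliftable {X : Type*} [TopologicalSpace X] (S : X ≃ₜ X) (n m k : ℕ)
    (x : W n → C(X, ℂ)) (y : Fin m → C(X, ℂ)) : Prop :=
  ∃ (α : X → W n) (q : X → Fin m),
    IsSpiralMap S n α ∧ IsFiberProjections α x ∧
    Continuous q ∧ Function.Surjective q ∧ IsFiberProjections q y ∧
    Refines (fiberPartition q) (fiberPartition α) ∧
    ¬ ∃ β : X → W (n + k), IsSpiralMap S (n + k) β ∧
      Refines (fiberPartition β) (fiberPartition q) ∧ α = xi n k ∘ β

/-- `Σ_{n,m} = {ψ_{n,m,k} | k ≥ 1, m < f (n + k)}`. -/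
def typeSet (ψ : (n m k : ℕ) → Formula (W n ⊕ Fin m)) (n m : ℕ) : Set (Formula (W n ⊕ Fin m)) :=
  {χ | ∃ k : ℕ, 1 ≤ k ∧ m < f (n + k) ∧ χ = ψ n m k}

end CantorLifting

/-! A finite partition of unity in `C(X)` into non-zero projections is the same as a continuous
surjection from `X` onto a finite discrete set. The relation `R` holds along orbits exactly when `z
i * σ (z j) = 0` for all pairs outside `R`, and `α = h ∘ φ` exactly when `z i * x (h i) = z i` for
all `i`. Each condition is thus the vanishing of a non-negative quantifier-free formula
(`partDefect`, `relDefect`, `linkDefect`).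

The delicate clause is the absence of a lift, since a negated existential is not in general a closed
condition. Here it is one, by weak stability: a tuple of sufficiently small defect can be rounded to
an exact map onto the finite set (`exists_isNear`). Hence the infimum of the defect over all
candidate lifts is either `0` or at least `tolerance`, and `tolerance - inf ≤ 0` says that there is
no lift (`infAll_liftFormula_lt_iff`, `holds_unliftable_iff`).

A realization of the whole type is then a pair `(α, q)` with no lift at any admissible `k`. Omitting
the types is the lifting property up to the bounds `f n < m < f (n + k)`; these are absorbed by
splitting a cell once more, which is possible in a perfect profinite space (`exists_refinement`). In
the metric case small diameter and refinement of a clopen partition are interchangeable, by a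
Lebesgue number.

That each set is a type is witnessed by the shift on bi-infinite paths in `W n`, with free bits
added to destroy isolated points. Modulo finite windows every path looks, after a long delay, like
one running around a left cycle, so a continuous shift-invariant function takes at most `6 ^ n`
values. The word of a map onto `W (n + k)` is such a function and would need `6 ^ (n + k)` values
(`PathSpace.not_exists_isSpiralMap`). -/

namespace CantorLifting

/-! ## Connectives, finite sums of terms, and iterated quantifiers -/

/-- The difference of two terms. -/
def CTerm.sub {α : Type} (s t : CTerm α) : CTerm α := .add s (.smul (-1) t)

@[simp] lemma CTerm.eval_sub {α : Type} {A : Type*} [CStarAlgebra A] (σ : A ≃⋆ₐ[ℂ] A) (v : α → A)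
    (s t : CTerm α) : (s.sub t).eval σ v = s.eval σ v - t.eval σ v := by
  simp [CTerm.sub, CTerm.eval, sub_eq_add_neg]

/-- The sum of a finite family of terms. -/
noncomputable def CTerm.sum {α ι : Type} [Fintype ι] (t : ι → CTerm α) : CTerm α :=
  ((Finset.univ : Finset ι).toList.map t).foldr CTerm.add .zero

@[simp] lemma CTerm.eval_sum {α ι : Type} [Fintype ι] {A : Type*} [CStarAlgebra A]
    (σ : A ≃⋆ₐ[ℂ] A) (v : α → A) (t : ι → CTerm α) :
    (CTerm.sum t).eval σ v = ∑ i, (t i).eval σ v := by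
  have h : ∀ l : List ι, ((l.map t).foldr CTerm.add .zero).eval σ v
      = (l.map fun i => (t i).eval σ v).sum := by
    intro l
    induction l with
    | nil => rfl
    | cons a l ih => simp [CTerm.eval, ih]
  rw [CTerm.sum, h, Finset.sum_map_toList]

namespace BdFormula

/-- The sum of a finite family of formulas. -/
noncomputable def sum {α ι : Type} [Fintype ι] {n : ℕ} (φ : ι → BdFormula α n) : BdFormula α n :=
  .conn (Fintype.card ι) ⟨fun x => ∑ i, x i, by fun_prop⟩ fun i => φ ((Fintype.equivFin ι).symm i)

/-- The product of a finite family of formulas. -/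
noncomputable def prod {α ι : Type} [Fintype ι] {n : ℕ} (φ : ι → BdFormula α n) : BdFormula α n :=
  .conn (Fintype.card ι) ⟨fun x => ∏ i, x i, by fun_prop⟩ fun i => φ ((Fintype.equivFin ι).symm i)

/-- The sum of two formulas. -/
def add {α : Type} {n : ℕ} (φ χ : BdFormula α n) : BdFormula α n :=
  .conn 2 ⟨fun x => x 0 + x 1, by fun_prop⟩ ![φ, χ]

/-- A unary connective applied to a formula. -/
def map {α : Type} {n : ℕ} (u : C(ℝ, ℝ)) (φ : BdFormula α n) : BdFormula α n :=
  .conn 1 ⟨fun x => u (x 0), by fun_prop⟩ fun _ => φ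

/-- Infima over the unit ball in all the variables that are waiting to be bound. -/
def infAll {α : Type} : {n : ℕ} → BdFormula α n → BdFormula α 0
  | 0, φ => φ
  | _ + 1, φ => infAll (.inf 1 φ)

section value

variable {α : Type} {A : Type*} [CStarAlgebra A] (σ : A ≃⋆ₐ[ℂ] A) (v : α → A) {n : ℕ}
  (w : Fin n → A)

@[simp] lemma value_norm (t : CTerm (α ⊕ Fin n)) :
    (BdFormula.norm t).value σ v w = ‖t.eval σ (Sum.elim v w)‖ := by
  rw [value]

@[simp] lemma value_sum {ι : Type} [Fintype ι] (φ : ι → BdFormula α n) :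
    (sum φ).value σ v w = ∑ i, (φ i).value σ v w := by
  rw [sum, value]
  exact (Fintype.equivFin ι).symm.sum_comp fun i => (φ i).value σ v w

@[simp] lemma value_prod {ι : Type} [Fintype ι] (φ : ι → BdFormula α n) :
    (prod φ).value σ v w = ∏ i, (φ i).value σ v w := by
  rw [prod, value]
  exact (Fintype.equivFin ι).symm.prod_comp fun i => (φ i).value σ v w

@[simp] lemma value_add (φ χ : BdFormula α n) :
    (add φ χ).value σ v w = φ.value σ v w + χ.value σ v w := by
  rw [add, value]
  rfl

@[simp] lemma value_map (u : C(ℝ, ℝ)) (φ : BdFormula α n) :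
    (map u φ).value σ v w = u (φ.value σ v w) := by
  rw [map, value]
  rfl

lemma value_inf_nonneg {R : ℕ} (φ : BdFormula α (n + 1)) (h : ∀ w, 0 ≤ φ.value σ v w) :
    0 ≤ (BdFormula.inf R φ).value σ v w := by
  rw [value]
  exact Real.iInf_nonneg fun _ => h _

lemma value_inf_lt_iff {R : ℕ} (φ : BdFormula α (n + 1)) (h : ∀ w, 0 ≤ φ.value σ v w) (δ : ℝ) :
    (BdFormula.inf R φ).value σ v w < δ ↔ ∃ b : A, ‖b‖ ≤ R ∧ φ.value σ v (Fin.snoc w b) < δ := by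
  rw [value]
  -- A real infimum over an empty or unbounded-below family has the default value `0`; both cases
  -- are excluded first.
  have : Nonempty {b : A // ‖b‖ ≤ (R : ℝ)} := ⟨⟨0, by simp⟩⟩
  have hb : BddBelow (Set.range fun b : {b : A // ‖b‖ ≤ (R : ℝ)} =>
      φ.value σ v (Fin.snoc w b.1)) := ⟨0, by rintro _ ⟨b, rfl⟩; exact h _⟩
  constructor
  · intro hlt
    obtain ⟨b, hb⟩ := exists_lt_of_ciInf_lt hlt
    exact ⟨b.1, b.2, hb⟩
  · rintro ⟨b, hbR, hlt⟩
    exact (ciInf_le hb ⟨b, hbR⟩).trans_lt hlt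

/-- A strict upper bound on an infimum has a witness even if the infimum is not attained, so the
quantifiers can be removed one at a time. -/
lemma value_infAll_lt_iff (φ : BdFormula α n) (h : ∀ w, 0 ≤ φ.value σ v w) (δ : ℝ) :
    φ.infAll.value σ v Fin.elim0 < δ ↔
      ∃ w : Fin n → A, (∀ i, ‖w i‖ ≤ 1) ∧ φ.value σ v w < δ := by
  induction n with
  | zero =>
    rw [infAll]
    constructor
    · exact fun hlt => ⟨Fin.elim0, fun i => i.elim0, hlt⟩
    · rintro ⟨w, -, hlt⟩
      rwa [Subsingleton.elim w Fin.elim0] at hlt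
  | succ n ih =>
    rw [infAll, ih (.inf 1 φ) fun w => value_inf_nonneg σ v w φ h]
    constructor
    · rintro ⟨w, hw, hlt⟩
      obtain ⟨b, hb, hlt⟩ := (value_inf_lt_iff σ v w φ h δ).1 hlt
      refine ⟨Fin.snoc w b, fun i => ?_, hlt⟩
      refine Fin.lastCases ?_ (fun j => ?_) i
      · simpa using hb
      · simpa using hw j
    · rintro ⟨w, hw, hlt⟩
      refine ⟨Fin.init w, fun i => hw _, (value_inf_lt_iff σ v _ φ h δ).2
        ⟨w (Fin.last n), by simpa using hw _, ?_⟩⟩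
      rwa [Fin.snoc_init_self]

end value

end BdFormula

/-! ## Defects of tuples, and the formulas that express them -/

section defects

variable {V U : Type} [Fintype V] {A : Type*} [CStarAlgebra A]

open Classical in
/-- The deviation of a tuple from a partition of unity into non-zero projections. -/
noncomputable def partDefect (z : V → A) : ℝ :=
  (∑ i, (‖z i * z i - z i‖ + |1 - ‖z i‖| + ∑ j, if i = j then 0 else ‖z i * z j‖)) + ‖∑ i, z i - 1‖

open Classical in
/-- The extent to which a tuple violates the relation `R`. -/
noncomputable def relDefect (σ : A ≃⋆ₐ[ℂ] A) (R : V → V → Prop) (z : V → A) : ℝ :=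
  ∑ i, ∑ j, if R i j then 0 else ‖z i * σ (z j)‖

/-- The extent to which the `z i` fail to lie below the `x (h i)`. -/
noncomputable def linkDefect (h : V → U) (z : V → A) (x : U → A) : ℝ :=
  ∑ i, ‖z i * x (h i) - z i‖

lemma partDefect_nonneg (z : V → A) : 0 ≤ partDefect z := by
  unfold partDefect
  refine add_nonneg (Finset.sum_nonneg fun i _ => add_nonneg (by positivity)
    (Finset.sum_nonneg fun j _ => ?_)) (norm_nonneg _)
  split_ifs <;> positivity

lemma relDefect_nonneg (σ : A ≃⋆ₐ[ℂ] A) (R : V → V → Prop) (z : V → A) : 0 ≤ relDefect σ R z := by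
  refine Finset.sum_nonneg fun i _ => Finset.sum_nonneg fun j _ => ?_
  split_ifs <;> positivity

lemma linkDefect_nonneg (h : V → U) (z : V → A) (x : U → A) : 0 ≤ linkDefect h z x :=
  Finset.sum_nonneg fun _ _ => norm_nonneg _

namespace BdFormula

variable {α : Type} {n : ℕ}

open Classical in
/-- The formula for `partDefect`. -/
noncomputable def part (t : V → CTerm (α ⊕ Fin n)) : BdFormula α n :=
  add (sum fun i => add (add (norm ((CTerm.mul (t i) (t i)).sub (t i)))
      (map ⟨fun r => |1 - r|, by fun_prop⟩ (norm (t i))))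
      (sum fun j => norm (if i = j then .zero else .mul (t i) (t j))))
    (norm ((CTerm.sum t).sub .one))

open Classical in
/-- The formula for `relDefect`. -/
noncomputable def rel (R : V → V → Prop) (t : V → CTerm (α ⊕ Fin n)) : BdFormula α n :=
  sum fun i => sum fun j => norm (if R i j then .zero else .mul (t i) (.aut (t j)))

/-- The formula for `linkDefect`. -/
noncomputable def link (h : V → U) (t : V → CTerm (α ⊕ Fin n)) (s : U → CTerm (α ⊕ Fin n)) :
    BdFormula α n :=
  sum fun i => norm ((CTerm.mul (t i) (s (h i))).sub (t i))

variable (σ : A ≃⋆ₐ[ℂ] A) (v : α → A) (w : Fin n → A)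

@[simp] lemma value_part (t : V → CTerm (α ⊕ Fin n)) :
    (part t).value σ v w = partDefect fun i => (t i).eval σ (Sum.elim v w) := by
  simp only [part, value_add, value_sum, value_norm, value_map, CTerm.eval_sub, CTerm.eval_sum,
    CTerm.eval, partDefect, ContinuousMap.coe_mk]
  congr! 5 with i _ j _
  split_ifs <;> simp [CTerm.eval]

@[simp] lemma value_rel (R : V → V → Prop) (t : V → CTerm (α ⊕ Fin n)) :
    (rel R t).value σ v w = relDefect σ R fun i => (t i).eval σ (Sum.elim v w) := by
  simp only [rel, value_sum, value_norm, relDefect]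
  congr! 4 with i _ j _
  split_ifs <;> simp [CTerm.eval]

@[simp] lemma value_link (h : V → U) (t : V → CTerm (α ⊕ Fin n)) (s : U → CTerm (α ⊕ Fin n)) :
    (link h t s).value σ v w = linkDefect h (fun i => (t i).eval σ (Sum.elim v w))
      fun i => (s i).eval σ (Sum.elim v w) := by
  simp only [link, value_sum, value_norm, CTerm.eval_sub, CTerm.eval, linkDefect]

end BdFormula

end defects

/-! ## Tuples with small defects in `C(X)` are close to tuples of projections -/

section bounds

variable {V U : Type} [Fintype V] {A : Type*} [CStarAlgebra A] {δ : ℝ}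

lemma norm_lt_of_partDefect_lt {z : V → A} (h : partDefect z < δ) :
    (∀ i, ‖z i * z i - z i‖ < δ) ∧ (∀ i, |1 - ‖z i‖| < δ) ∧
      (∀ i j, i ≠ j → ‖z i * z j‖ < δ) ∧ ‖∑ i, z i - 1‖ < δ := by
  classical
  have h3 : ∀ i j, 0 ≤ if i = j then (0 : ℝ) else ‖z i * z j‖ := fun i j => by
    split_ifs <;> positivity
  have h0 : ∀ i, 0 ≤ ∑ j, if i = j then (0 : ℝ) else ‖z i * z j‖ :=
    fun i => Finset.sum_nonneg fun j _ => h3 i j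
  have h1 : ∀ i, 0 ≤ ‖z i * z i - z i‖ + |1 - ‖z i‖| +
      ∑ j, if i = j then (0 : ℝ) else ‖z i * z j‖ := fun i => add_nonneg (by positivity) (h0 i)
  have hle : ∀ i, ‖z i * z i - z i‖ + |1 - ‖z i‖| +
      (∑ j, if i = j then (0 : ℝ) else ‖z i * z j‖) < δ := fun i => by
    refine lt_of_le_of_lt ?_ h
    have := Finset.single_le_sum (f := fun i => ‖z i * z i - z i‖ + |1 - ‖z i‖| +
      ∑ j, if i = j then (0 : ℝ) else ‖z i * z j‖) (fun i _ => h1 i) (Finset.mem_univ i)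
    unfold partDefect
    convert this.trans (le_add_of_nonneg_right (norm_nonneg (∑ i, z i - 1))) using 1
  refine ⟨fun i => ?_, fun i => ?_, fun i j hij => ?_, ?_⟩
  · have := hle i; have := h0 i; have := abs_nonneg (1 - ‖z i‖); linarith
  · have := hle i; have := h0 i; have := norm_nonneg (z i * z i - z i); linarith
  · have h5 := hle i
    have h4 := Finset.single_le_sum (fun j _ => h3 i j) (Finset.mem_univ j)
    rw [if_neg hij] at h4
    have := abs_nonneg (1 - ‖z i‖); have := norm_nonneg (z i * z i - z i); linarith
  · refine lt_of_le_of_lt ?_ h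
    unfold partDefect
    convert le_add_of_nonneg_left (Finset.sum_nonneg fun i (_ : i ∈ Finset.univ) => h1 i) using 1

lemma norm_lt_of_relDefect_lt {σ : A ≃⋆ₐ[ℂ] A} {R : V → V → Prop} {z : V → A}
    (h : relDefect σ R z < δ) {i j : V} (hij : ¬ R i j) : ‖z i * σ (z j)‖ < δ := by
  classical
  have h3 : ∀ i j, 0 ≤ if R i j then (0 : ℝ) else ‖z i * σ (z j)‖ := fun i j => by
    split_ifs <;> positivity
  have h4 := Finset.single_le_sum (fun j _ => h3 i j) (Finset.mem_univ j)
  have h5 := Finset.single_le_sum (f := fun i => ∑ j, if R i j then (0 : ℝ) else ‖z i * σ (z j)‖)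
    (fun i _ => Finset.sum_nonneg fun j _ => h3 i j) (Finset.mem_univ i)
  rw [if_neg hij] at h4
  refine (h4.trans ?_).trans_lt h
  unfold relDefect
  convert h5 using 1

lemma norm_lt_of_linkDefect_lt {h : V → U} {z : V → A} {x : U → A}
    (hd : linkDefect h z x < δ) (i : V) : ‖z i * x (h i) - z i‖ < δ :=
  (Finset.single_le_sum (f := fun i => ‖z i * x (h i) - z i‖) (fun _ _ => norm_nonneg _)
    (Finset.mem_univ i)).trans_lt hd

end bounds

variable {X : Type*} [TopologicalSpace X] {V U : Type}

/-- The tuple `z` is within distance `1 / 4` of the indicator functions of the fibres of `φ`. -/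
def IsNear (φ : X → V) (z : V → C(X, ℂ)) : Prop :=
  ∀ i p, (φ p = i → ‖z i p - 1‖ < 1 / 4) ∧ (φ p ≠ i → ‖z i p‖ < 1 / 4)

namespace IsFiberProjections

variable {φ : X → V} {z : V → C(X, ℂ)}

lemma apply_eq_one (h : IsFiberProjections φ z) {i : V} {p : X} (hp : φ p = i) : z i p = 1 := by
  rw [h, Set.indicator_of_mem (by simpa using hp)]

lemma apply_eq_zero (h : IsFiberProjections φ z) {i : V} {p : X} (hp : φ p ≠ i) : z i p = 0 := by
  rw [h, Set.indicator_of_notMem (by simpa using hp)]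

lemma isNear (h : IsFiberProjections φ z) : IsNear φ z := fun i p =>
  ⟨fun hp => by simp [h.apply_eq_one hp], fun hp => by simp [h.apply_eq_zero hp]⟩

lemma norm_eq_one [CompactSpace X] (h : IsFiberProjections φ z) (hs : Function.Surjective φ) (i : V) :
    ‖z i‖ = 1 := by
  obtain ⟨p, hp⟩ := hs i
  refine le_antisymm ((ContinuousMap.norm_le _ zero_le_one).2 fun q => ?_) ?_
  · by_cases hq : φ q = i
    · simp [h.apply_eq_one hq]
    · simp [h.apply_eq_zero hq]
  · have := ContinuousMap.norm_coe_le_norm (z i) p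
    rwa [h.apply_eq_one hp, norm_one] at this

end IsFiberProjections

lemma exists_isFiberProjections [TopologicalSpace V] [DiscreteTopology V] {φ : X → V}
    (hφ : Continuous φ) : ∃ z : V → C(X, ℂ), IsFiberProjections φ z := by
  refine ⟨fun i => ⟨Set.indicator (φ ⁻¹' {i}) fun _ => 1, ?_⟩, fun i p => rfl⟩
  exact (IsClopen.preimage (isClopen_discrete {i}) hφ).continuous_indicator continuous_const

namespace IsNear

variable {φ : X → V} {z : V → C(X, ℂ)}

lemma lt_norm (h : IsNear φ z) {i : V} {p : X} (hp : φ p = i) : 3 / 4 < ‖z i p‖ := by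
  have h1 := (h i p).1 hp
  have h2 := norm_sub_norm_le (1 : ℂ) (1 - z i p)
  rw [norm_sub_rev] at h1
  simp only [norm_one, sub_sub_cancel] at h2
  linarith

/-- Continuity is automatic, even for a `φ` chosen pointwise: `‖z i‖` avoids the interval from `1 /
4` to `3 / 4`, so the fibre over `i` is the open set where it exceeds `1 / 2`. -/
lemma continuous [TopologicalSpace V] [DiscreteTopology V] (h : IsNear φ z) : Continuous φ := by
  rw [continuous_discrete_rng]
  intro i
  have : φ ⁻¹' {i} = {p | 1 / 2 < ‖z i p‖} := by
    ext p
    simp only [Set.mem_preimage, Set.mem_singleton_iff, Set.mem_ofPred_eq]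
    constructor
    · intro hp; have := h.lt_norm hp; linarith
    · intro hp
      by_contra hne
      have := (h i p).2 hne
      linarith
  rw [this]
  exact isOpen_lt continuous_const (by fun_prop)

variable [CompactSpace X]

/-- At a point violating `R`, both factors of `z i * σ (z j)` exceed `3 / 4`, so its norm exceeds `9
/ 16`. -/
lemma rel_of_lt [Fintype V] (h : IsNear φ z) {S : X ≃ₜ X} {R : V → V → Prop}
    (hd : relDefect (dualAut S) R z < 1 / 8) (p : X) : R (φ p) (φ (S p)) := by
  by_contra hR
  have h1 := norm_lt_of_relDefect_lt hd hR
  have h2 := ContinuousMap.norm_coe_le_norm (z (φ p) * dualAut S (z (φ (S p)))) p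
  have h3 : (z (φ p) * dualAut S (z (φ (S p)))) p = z (φ p) p * z (φ (S p)) (S p) := rfl
  rw [h3, norm_mul] at h2
  have h4 := h.lt_norm (p := p) rfl
  have h5 := h.lt_norm (p := S p) rfl
  nlinarith

lemma eq_of_lt [Fintype V] (h : IsNear φ z) {α : X → U} {x : U → C(X, ℂ)} (hx : IsNear α x)
    {g : V → U} (hd : linkDefect g z x < 1 / 8) (p : X) : α p = g (φ p) := by
  by_contra hne
  have h1 := norm_lt_of_linkDefect_lt hd (φ p)
  have h2 := ContinuousMap.norm_coe_le_norm (z (φ p) * x (g (φ p)) - z (φ p)) p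
  have h3 : (z (φ p) * x (g (φ p)) - z (φ p)) p = z (φ p) p * (x (g (φ p)) p - 1) := by
    simp only [ContinuousMap.sub_apply, ContinuousMap.mul_apply]; ring
  rw [h3, norm_mul] at h2
  have h4 := h.lt_norm (p := p) rfl
  have h5 := (hx _ p).2 hne
  have h6 := norm_sub_norm_le (1 : ℂ) (x (g (φ p)) p)
  rw [norm_sub_rev (1 : ℂ), norm_one] at h6
  nlinarith

end IsNear

variable [CompactSpace X] [Fintype V]

/-- The tolerance below which a tuple indexed by `V` can be rounded to a partition. -/
noncomputable def tolerance (V : Type) [Fintype V] : ℝ := 1 / (4 * Fintype.card V + 8)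

lemma tolerance_pos : 0 < tolerance V := by unfold tolerance; positivity

lemma tolerance_le : tolerance V ≤ 1 / 8 := by
  unfold tolerance
  gcongr
  have : (0 : ℝ) ≤ Fintype.card V := by positivity
  linarith

/-- Near-idempotence puts every value near `0` or near `1`. At each point the sum condition forces
some coordinate near `1`, and near-orthogonality allows only one; this coordinate is `φ p`.
Surjectivity comes from the condition that each `‖z i‖` is near `1`. -/
lemma exists_isNear {z : V → C(X, ℂ)} (h : partDefect z < tolerance V) :
    ∃ φ : X → V, IsNear φ z ∧ Function.Surjective φ := by
  have hle : tolerance V ≤ 1 / 8 := tolerance_le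
  have hpos : 0 < tolerance V := tolerance_pos
  have hcard : tolerance V * (4 * Fintype.card V + 8) = 1 := by
    unfold tolerance; field_simp
  set δ := tolerance V
  obtain ⟨h1, h2, h3, h4⟩ := norm_lt_of_partDefect_lt h
  have hdich : ∀ i p, ‖z i p‖ < 2 * δ ∨ ‖z i p - 1‖ < 2 * δ := by
    intro i p
    have h5 := (ContinuousMap.norm_coe_le_norm (z i * z i - z i) p).trans_lt (h1 i)
    have h6 : (z i * z i - z i) p = z i p * (z i p - 1) := by
      simp only [ContinuousMap.sub_apply, ContinuousMap.mul_apply]; ring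
    rw [h6, norm_mul] at h5
    by_contra! hc
    have h7 := norm_sub_norm_le (1 : ℂ) (1 - z i p)
    rw [norm_sub_rev (1 : ℂ) (z i p), sub_sub_cancel, norm_one] at h7
    rcases le_total ‖z i p‖ (1 / 2) with h8 | h8 <;> nlinarith [hc.1, hc.2]
  have hone : ∀ i p, ¬ ‖z i p‖ < 2 * δ → 3 / 4 < ‖z i p‖ ∧ ‖z i p - 1‖ < 1 / 4 := by
    intro i p hi
    have h5 := (hdich i p).resolve_left hi
    have h7 := norm_sub_norm_le (1 : ℂ) (1 - z i p)
    rw [norm_sub_rev (1 : ℂ) (z i p), sub_sub_cancel, norm_one] at h7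
    exact ⟨by linarith, by linarith⟩
  have hex : ∀ p, ∃ i, ¬ ‖z i p‖ < 2 * δ := by
    intro p
    by_contra! hc
    have h5 := (ContinuousMap.norm_coe_le_norm (∑ i, z i - 1) p).trans_lt h4
    rw [ContinuousMap.sub_apply, ContinuousMap.sum_apply, ContinuousMap.one_apply] at h5
    -- The size of `tolerance` is dictated by this bound: it gives `card V * (2 * δ) + δ < 1`, so
    -- the values cannot all be small.
    have h6 : ‖∑ i, z i p‖ ≤ Fintype.card V * (2 * δ) := by
      refine (norm_sum_le _ _).trans ((Finset.sum_le_sum fun i _ => (hc i).le).trans ?_)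
      simp
    have h7 := norm_sub_norm_le (1 : ℂ) (∑ i, z i p)
    rw [norm_sub_rev (1 : ℂ), norm_one] at h7
    nlinarith
  choose φ hφ using hex
  have huniq : ∀ i p, φ p ≠ i → ‖z i p‖ < 2 * δ := by
    intro i p hne
    by_contra hc
    have h5 := (ContinuousMap.norm_coe_le_norm (z (φ p) * z i) p).trans_lt (h3 _ _ hne)
    rw [ContinuousMap.mul_apply, norm_mul] at h5
    have h6 := (hone _ _ hc).1
    have h7 := (hone _ _ (hφ p)).1
    nlinarith
  refine ⟨φ, fun i p => ⟨?_, fun hne => ?_⟩, fun i => ?_⟩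
  · rintro rfl
    exact (hone _ _ (hφ p)).2
  · have := huniq i p hne
    linarith
  · by_contra! hc
    have h5 := (ContinuousMap.norm_le (z i) (C := 1 / 4) (by norm_num)).2 fun p => by
      have := huniq i p (hc p); linarith
    have h6 := abs_lt.1 (h2 i)
    linarith

lemma exists_isFiberProjections_of_partDefect_eq_zero {z : V → C(X, ℂ)} (h : partDefect z = 0) :
    ∃ φ : X → V, IsFiberProjections φ z ∧ Function.Surjective φ := by
  obtain ⟨φ, hn, hs⟩ := exists_isNear (h.trans_lt tolerance_pos)
  have hidem : ∀ i p, z i p = 0 ∨ z i p = 1 := by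
    intro i p
    have h1 : ‖z i * z i - z i‖ = 0 := le_antisymm (le_of_forall_pos_le_add fun ε hε => by
      rw [zero_add]; exact ((norm_lt_of_partDefect_lt (h.trans_lt hε)).1 i).le) (norm_nonneg _)
    have h2 : z i p * (z i p - 1) = 0 := by
      have := DFunLike.congr_fun (norm_eq_zero.1 h1) p
      simp only [ContinuousMap.sub_apply, ContinuousMap.mul_apply, ContinuousMap.zero_apply] at this
      linear_combination this
    rcases mul_eq_zero.1 h2 with h3 | h3
    · exact Or.inl h3
    · exact Or.inr (sub_eq_zero.1 h3)
  refine ⟨φ, fun i p => ?_, hs⟩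
  by_cases hp : φ p = i
  · rw [Set.indicator_of_mem (by simpa using hp)]
    refine (hidem i p).resolve_left fun h0 => ?_
    have := (hn i p).1 hp
    rw [h0] at this
    norm_num at this
  · rw [Set.indicator_of_notMem (by simpa using hp)]
    refine (hidem i p).resolve_right fun h0 => ?_
    have := (hn i p).2 hp
    rw [h0] at this
    norm_num at this

namespace IsFiberProjections

variable {φ : X → V} {z : V → C(X, ℂ)}

lemma partDefect_eq_zero (h : IsFiberProjections φ z) (hs : Function.Surjective φ) :
    partDefect z = 0 := by
  classical
  have h1 : ∀ i, z i * z i - z i = 0 := fun i => by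
    ext p
    by_cases hp : φ p = i
    · simp [h.apply_eq_one hp]
    · simp [h.apply_eq_zero hp]
  have h2 : ∀ i j, i ≠ j → z i * z j = 0 := fun i j hij => by
    ext p
    by_cases hp : φ p = i
    · simp [h.apply_eq_zero (i := j) (p := p) (by rwa [hp])]
    · simp [h.apply_eq_zero hp]
  have h3 : ∑ i, z i - 1 = 0 := by
    ext p
    have : ∀ i, z i p = if φ p = i then 1 else 0 := fun i => by
      split_ifs with hp
      · exact h.apply_eq_one hp
      · exact h.apply_eq_zero hp
    simp [ContinuousMap.sum_apply, this]
  unfold partDefect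
  rw [h3, norm_zero, add_zero]
  refine Finset.sum_eq_zero fun i _ => ?_
  rw [h1, h.norm_eq_one hs, norm_zero, sub_self, abs_zero, add_zero, zero_add]
  refine Finset.sum_eq_zero fun j _ => ?_
  split_ifs with hij
  · rfl
  · rw [h2 i j hij, norm_zero]

lemma relDefect_eq_zero (h : IsFiberProjections φ z) {S : X ≃ₜ X} {R : V → V → Prop}
    (hR : ∀ p, R (φ p) (φ (S p))) : relDefect (dualAut S) R z = 0 := by
  classical
  refine Finset.sum_eq_zero fun i _ => Finset.sum_eq_zero fun j _ => ?_
  split_ifs with hij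
  · rfl
  rw [norm_eq_zero]
  ext p
  change z i p * z j (S p) = 0
  by_cases hp : φ p = i
  · rw [h.apply_eq_zero (p := S p), mul_zero]
    rintro rfl
    exact hij (hp ▸ hR p)
  · rw [h.apply_eq_zero hp, zero_mul]

lemma linkDefect_eq_zero (h : IsFiberProjections φ z) {α : X → U} {x : U → C(X, ℂ)}
    (hx : IsFiberProjections α x) {g : V → U} (hg : ∀ p, α p = g (φ p)) :
    linkDefect g z x = 0 := by
  refine Finset.sum_eq_zero fun i _ => ?_
  rw [norm_eq_zero]
  ext p
  simp only [ContinuousMap.sub_apply, ContinuousMap.mul_apply, ContinuousMap.zero_apply]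
  by_cases hp : φ p = i
  · rw [hx.apply_eq_one (by rw [hg, hp]), mul_one, sub_self]
  · rw [h.apply_eq_zero hp, zero_mul, sub_self]

end IsFiberProjections

/-! ## The formulas `ψ_{n,m,k}` -/

/-- A spiral consists of two cycles and a segment. -/
def spiralEquiv (n : ℕ) : Spiral n ≃
    ZMod n.factorial ⊕ Set.Icc (-(n : ℤ) + 1) ((n : ℤ) - 1) ⊕ ZMod n.factorial where
  toFun
    | .l k => .inl k
    | .m k => .inr (.inl k)
    | .r k => .inr (.inr k)
  invFun
    | .inl k => .l k
    | .inr (.inl k) => .m k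
    | .inr (.inr k) => .r k
  left_inv := by rintro (k | k | k) <;> rfl
  right_inv := by rintro (k | k | k) <;> rfl

instance (n : ℕ) : NeZero n.factorial := ⟨n.factorial_ne_zero⟩

noncomputable instance (n : ℕ) : Fintype (Spiral n) := Fintype.ofEquiv _ (spiralEquiv n).symm

lemma card_spiral {n : ℕ} (hn : 1 ≤ n) :
    Fintype.card (Spiral n) = 2 * n.factorial + 2 * n - 1 := by
  rw [Fintype.card_congr (spiralEquiv n), Fintype.card_sum, Fintype.card_sum, ZMod.card,
    ← Set.toFinset_card, Set.toFinset_Icc, Int.card_Icc]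
  omega

/-- A point of `W n` is a word and a point of the spiral. -/
def wEquiv (n : ℕ) : W n ≃ (Fin n → Letter) × Spiral n where
  toFun x := (x.word, x.pt)
  invFun x := ⟨x.1, x.2⟩

noncomputable instance : DecidableEq Kind := Classical.decEq _

noncomputable instance : Fintype Kind := ⟨{Kind.L, Kind.M, Kind.G}, by rintro (_ | _ | _) <;> simp⟩

lemma card_kind : Fintype.card Kind = 3 := by
  change Finset.card {Kind.L, Kind.M, Kind.G} = 3
  simp

noncomputable instance (n : ℕ) : Fintype (W n) := Fintype.ofEquiv _ (wEquiv n).symm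

noncomputable instance (n : ℕ) : DecidableEq (W n) := Classical.decEq _

lemma card_words (n : ℕ) : Fintype.card (Fin n → Letter) = 6 ^ n := by
  rw [Fintype.card_fun, Fintype.card_fin, Fintype.card_prod, Fintype.card_fin, card_kind]

lemma card_W {n : ℕ} (hn : 1 ≤ n) : Fintype.card (W n) = f n := by
  rw [Fintype.card_congr (wEquiv n), Fintype.card_prod, card_words, card_spiral hn, f]

lemma lt_f {n : ℕ} (hn : 1 ≤ n) : n < f n := by
  have h1 := n.factorial_pos
  have h2 : n < 6 ^ n := Nat.lt_pow_self (by norm_num)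
  exact h2.trans_le (Nat.le_mul_of_pos_right _ (by omega))

/-- Refinement becomes the existence of one of finitely many maps `g`, over which a formula can
range by a finite sum or product. -/
lemma refines_fiberPartition_iff {X U V : Type*} {β : X → V} {q : X → U} :
    Refines (fiberPartition β) (fiberPartition q) ↔ ∃ g : V → U, ∀ p, q p = g (β p) := by
  constructor
  · intro h
    have h1 : ∀ v, ∃ u, ∀ p, β p = v → q p = u := by
      intro v
      obtain ⟨_, ⟨u, rfl⟩, hu⟩ := h _ ⟨v, rfl⟩
      exact ⟨u, fun p hp => hu hp⟩
    choose g hg using h1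
    exact ⟨g, fun p => hg _ p rfl⟩
  · rintro ⟨g, hg⟩ _ ⟨v, rfl⟩
    exact ⟨_, ⟨g v, rfl⟩, fun p hp => (hg p).trans (congrArg g hp)⟩

section formula

variable (n m k : ℕ)

/-- The variable for the projection of index `i` in a tuple waiting to be bound. -/
noncomputable def boundVar {α V : Type} [Fintype V] (i : V) :
    CTerm (α ⊕ Fin (Fintype.card V)) :=
  .var (.inr (Fintype.equivFin V i))

/-- The formula saying that the bound tuple encodes a map `β` onto `W (n + k)` such that
`α = ξ ∘ β` and `q = g ∘ β`. -/
noncomputable def liftFormula (g : W (n + k) → Fin m) :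
    BdFormula (W n ⊕ Fin m) (Fintype.card (W (n + k))) :=
  .add (.add (.part boundVar) (.rel (W.Rel (n + k)) boundVar))
    (.add (.link (xi n k) boundVar fun i => .var (.inl (.inl i)))
      (.link g boundVar fun j => .var (.inl (.inr j))))

/-- The formula expressing `IsUnliftable`. -/
noncomputable def unliftable : Formula (W n ⊕ Fin m) :=
  .add
    (.add (.add (.part fun i => .var (.inl (.inl i)))
        (.rel (W.Rel n) fun i => .var (.inl (.inl i))))
      (.add (.part fun j => .var (.inl (.inr j)))
        -- A product vanishes when one factor does: a finite disjunction over `h`.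
        (.prod fun h : Fin m → W n =>
          .link h (fun j => .var (.inl (.inr j))) fun i => .var (.inl (.inl i)))))
    (.sum fun g : W (n + k) → Fin m =>
      -- Vanishes exactly when the infimum is at least the tolerance; the sum over `g` is a finite
      -- conjunction.
      .map ⟨fun r => max 0 (tolerance (W (n + k)) - r), by fun_prop⟩
        (liftFormula n m k g).infAll)

variable {n m k}

lemma value_liftFormula {A : Type*} [CStarAlgebra A] (σ : A ≃⋆ₐ[ℂ] A) (x : W n → A)
    (y : Fin m → A) (w : Fin (Fintype.card (W (n + k))) → A) (g : W (n + k) → Fin m) :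
    (liftFormula n m k g).value σ (Sum.elim x y) w =
      partDefect (fun i => w (Fintype.equivFin _ i)) +
      relDefect σ (W.Rel (n + k)) (fun i => w (Fintype.equivFin _ i)) +
      (linkDefect (xi n k) (fun i => w (Fintype.equivFin _ i)) x +
        linkDefect g (fun i => w (Fintype.equivFin _ i)) y) := by
  simp [liftFormula, CTerm.eval, boundVar]

variable {X : Type*} [TopologicalSpace X] [CompactSpace X] {S : X ≃ₜ X}
  {x : W n → C(X, ℂ)} {y : Fin m → C(X, ℂ)}

lemma value_liftFormula_nonneg (g : W (n + k) → Fin m) (w) :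
    0 ≤ (liftFormula n m k g).value (dualAut S) (Sum.elim x y) w := by
  rw [value_liftFormula]
  exact add_nonneg (add_nonneg (partDefect_nonneg _) (relDefect_nonneg _ _ _))
    (add_nonneg (linkDefect_nonneg _ _ _) (linkDefect_nonneg _ _ _))

/-- The gap that makes non-existence definable: a tuple of small defect rounds to an exact lift, and
an exact lift has defect `0`. -/
lemma infAll_liftFormula_lt_iff {α : X → W n} {q : X → Fin m} (hα : IsFiberProjections α x)
    (hq : IsFiberProjections q y) (g : W (n + k) → Fin m) :
    (liftFormula n m k g).infAll.value (dualAut S) (Sum.elim x y) Fin.elim0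
        < tolerance (W (n + k)) ↔
      ∃ β : X → W (n + k), IsSpiralMap S (n + k) β ∧ (∀ p, q p = g (β p)) ∧ α = xi n k ∘ β := by
  rw [BdFormula.value_infAll_lt_iff _ _ _ (value_liftFormula_nonneg g)]
  simp only [value_liftFormula]
  constructor
  · rintro ⟨w, -, hlt⟩
    set z : W (n + k) → C(X, ℂ) := fun i => w (Fintype.equivFin _ i)
    have h1 := partDefect_nonneg z
    have h2 := relDefect_nonneg (dualAut S) (W.Rel (n + k)) z
    have h3 := linkDefect_nonneg (xi n k) z x
    have h4 := linkDefect_nonneg g z y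
    have h5 : tolerance (W (n + k)) ≤ 1 / 8 := tolerance_le
    obtain ⟨β, hn, hs⟩ := exists_isNear (z := z) (by linarith)
    refine ⟨β, ⟨hn.continuous, hs, hn.rel_of_lt (by linarith)⟩,
      hn.eq_of_lt hq.isNear (by linarith), ?_⟩
    exact funext (hn.eq_of_lt hα.isNear (by linarith))
  · rintro ⟨β, hβ, hg, hxi⟩
    obtain ⟨z, hz⟩ := exists_isFiberProjections hβ.continuous
    refine ⟨fun i => z ((Fintype.equivFin _).symm i), fun i => (hz.norm_eq_one hβ.surjective _).le,
      ?_⟩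
    simp only [Equiv.symm_apply_apply]
    rw [hz.partDefect_eq_zero hβ.surjective, hz.relDefect_eq_zero hβ.rel,
      hz.linkDefect_eq_zero hα (congrFun hxi), hz.linkDefect_eq_zero hq hg]
    simpa using tolerance_pos

theorem holds_unliftable_iff :
    Formula.Holds (dualAut S) (unliftable n m k) (Sum.elim x y) ↔ IsUnliftable S n m k x y := by
  have hsum : ∀ g : W (n + k) → Fin m, 0 ≤ max 0 (tolerance (W (n + k)) -
      (liftFormula n m k g).infAll.value (dualAut S) (Sum.elim x y) Fin.elim0) :=
    fun g => le_max_left _ _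
  have hprod : ∀ h : Fin m → W n, 0 ≤ linkDefect h y x := fun h => linkDefect_nonneg _ _ _
  have hval : Formula.Holds (dualAut S) (unliftable n m k) (Sum.elim x y) ↔
      ((partDefect x = 0 ∧ relDefect (dualAut S) (W.Rel n) x = 0) ∧
        partDefect y = 0 ∧ ∃ h : Fin m → W n, linkDefect h y x = 0) ∧
      ∀ g : W (n + k) → Fin m, ¬ (liftFormula n m k g).infAll.value (dualAut S) (Sum.elim x y)
        Fin.elim0 < tolerance (W (n + k)) := by
    rw [Formula.Holds, unliftable]
    simp only [BdFormula.value_add, BdFormula.value_part, BdFormula.value_rel,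
      BdFormula.value_prod, BdFormula.value_link, BdFormula.value_sum, BdFormula.value_map,
      CTerm.eval, Sum.elim_inl, Sum.elim_inr, ContinuousMap.coe_mk]
    have h1 := partDefect_nonneg x
    have h2 := relDefect_nonneg (dualAut S) (W.Rel n) x
    have h3 := partDefect_nonneg y
    have h4 := Finset.prod_nonneg fun h (_ : h ∈ Finset.univ) => hprod h
    have h5 := Finset.sum_nonneg fun g (_ : g ∈ Finset.univ) => hsum g
    rw [add_eq_zero_iff_of_nonneg (by positivity) h5, add_eq_zero_iff_of_nonneg (by positivity)
      (by positivity), add_eq_zero_iff_of_nonneg h1 h2, add_eq_zero_iff_of_nonneg h3 h4,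
      Finset.prod_eq_zero_iff, Finset.sum_eq_zero_iff_of_nonneg fun g _ => hsum g]
    simp
  rw [hval]
  constructor
  · rintro ⟨⟨⟨hx, hR⟩, hy, h, hh⟩, hno⟩
    obtain ⟨α, hα, hαs⟩ := exists_isFiberProjections_of_partDefect_eq_zero hx
    obtain ⟨q, hq, hqs⟩ := exists_isFiberProjections_of_partDefect_eq_zero hy
    refine ⟨α, q, ⟨hα.isNear.continuous, hαs, hα.isNear.rel_of_lt (by rw [hR]; norm_num)⟩, hα,
      hq.isNear.continuous, hqs, hq, refines_fiberPartition_iff.2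
        ⟨h, hq.isNear.eq_of_lt hα.isNear (by rw [hh]; norm_num)⟩, ?_⟩
    rintro ⟨β, hβ, hr, hxi⟩
    obtain ⟨g, hg⟩ := refines_fiberPartition_iff.1 hr
    exact hno g ((infAll_liftFormula_lt_iff hα hq g).2 ⟨β, hβ, hg, hxi⟩)
  · rintro ⟨α, q, hS, hα, hqc, hqs, hq, hr, hno⟩
    obtain ⟨h, hh⟩ := refines_fiberPartition_iff.1 hr
    refine ⟨⟨⟨hα.partDefect_eq_zero hS.surjective, hα.relDefect_eq_zero hS.rel⟩,
      hq.partDefect_eq_zero hqs, h, hq.linkDefect_eq_zero hα hh⟩, fun g hlt => hno ?_⟩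
    obtain ⟨β, hβ, hg, hxi⟩ := (infAll_liftFormula_lt_iff hα hq g).1 hlt
    exact ⟨β, hβ, refines_fiberPartition_iff.2 ⟨g, hg⟩, hxi⟩

end formula

/-! ## Omitting the types and the lifting property -/

lemma Refines.trans {X : Type*} {A B C : Set (Set X)} (h : Refines A B) (h' : Refines B C) :
    Refines A C := by
  intro U hU
  obtain ⟨V, hV, hUV⟩ := h U hU
  obtain ⟨T, hT, hVT⟩ := h' V hV
  exact ⟨T, hT, hUV.trans hVT⟩

/-- The conditions for different `k` each provide their own `α` and `q`; this identifies them, since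
all come from the same tuple. -/
lemma IsFiberProjections.unique {X V : Type*} [TopologicalSpace X] {φ φ' : X → V}
    {z : V → C(X, ℂ)} (h : IsFiberProjections φ z) (h' : IsFiberProjections φ' z) : φ = φ' := by
  funext p
  have h1 := h (φ p) p
  rw [Set.indicator_of_mem (by simp), h'] at h1
  by_contra hne
  rw [Set.indicator_of_notMem (by simpa using fun h => hne h.symm)] at h1
  exact zero_ne_one h1

lemma card_le_of_refines {X U V : Type*} [Fintype U] [Fintype V] {β : X → V} {q : X → U}
    (hq : Function.Surjective q) (h : Refines (fiberPartition β) (fiberPartition q)) :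
    Fintype.card U ≤ Fintype.card V := by
  obtain ⟨g, hg⟩ := refines_fiberPartition_iff.1 h
  refine Fintype.card_le_of_surjective g fun u => ?_
  obtain ⟨p, rfl⟩ := hq u
  exact ⟨β p, (hg p).symm⟩

lemma isClopenPartition_fiberPartition {X V : Type*} [TopologicalSpace X] [TopologicalSpace V]
    [DiscreteTopology V]
    {q : X → V} (hq : Continuous q) (hs : Function.Surjective q) :
    IsClopenPartition (fiberPartition q) := by
  refine ⟨⟨?_, fun p => ⟨q ⁻¹' {q p}, ⟨⟨q p, rfl⟩, rfl⟩, ?_⟩⟩, ?_⟩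
  · rintro ⟨v, hv⟩
    obtain ⟨p, hp⟩ := hs v
    exact (Set.ext_iff.1 hv p).1 hp
  · rintro _ ⟨⟨v, rfl⟩, hv⟩
    rw [show q p = v from hv]
  · rintro _ ⟨v, rfl⟩
    exact (isClopen_discrete _).preimage hq

/-! ### Finite clopen partitions and their refinements -/

section profinite

variable {X : Type*} [TopologicalSpace X] [CompactSpace X]

/-- The cells of a clopen partition of a compact space are the fibres of a continuous map onto a
finite set. -/
lemma IsClopenPartition.exists_map {A : Set (Set X)} (hA : IsClopenPartition A) :
    ∃ (N : ℕ) (q : X → Fin N), Continuous q ∧ Function.Surjective q ∧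
      Refines (fiberPartition q) A := by
  have h1 : ∀ p, ∃ U : A, p ∈ U.1 := fun p => by
    obtain ⟨U, ⟨hU, hp⟩, -⟩ := hA.1.2 p
    exact ⟨⟨U, hU⟩, hp⟩
  choose c hc using h1
  have huniq : ∀ (p : X) (U : A), p ∈ U.1 → c p = U := fun p U hp =>
    Subtype.ext ((hA.1.2 p).unique ⟨(c p).2, hc p⟩ ⟨U.2, hp⟩)
  let _ : TopologicalSpace A := ⊥
  have : DiscreteTopology A := ⟨rfl⟩
  have hcont : Continuous c := continuous_discrete_rng.2 fun U => by
    have : c ⁻¹' {U} = U.1 := by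
      ext p
      exact ⟨fun hp => by rw [← show c p = U from hp]; exact hc p, huniq p U⟩
    rw [this]
    exact (hA.2 _ U.2).2
  have hsurj : Function.Surjective c := fun U => by
    obtain ⟨p, hp⟩ : U.1.Nonempty := Set.nonempty_iff_ne_empty.2 fun h => hA.1.1 (h ▸ U.2)
    exact ⟨p, huniq p U hp⟩
  -- Finiteness of the partition: its set of cells is discrete and a continuous image of `X`.
  have : CompactSpace A := hsurj.compactSpace hcont
  have : Finite A := finite_of_compact_of_discrete
  let e := Finite.equivFin A
  refine ⟨Nat.card A, e ∘ c, continuous_of_discreteTopology.comp hcont, e.surjective.comp hsurj, ?_⟩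
  rintro _ ⟨j, rfl⟩
  refine ⟨(e.symm j).1, (e.symm j).2, fun p hp => ?_⟩
  have : c p = e.symm j := by rw [Equiv.eq_symm_apply]; exact hp
  exact this ▸ hc p

variable [T2Space X] [TotallyDisconnectedSpace X] [PerfectSpace X]

/-- As `x` is not isolated, its cell contains another point `y`. A clopen neighbourhood of `x`
inside the cell that avoids `y` becomes the new cell, and `y` keeps the old one non-empty. -/
lemma exists_refinement_succ {m : ℕ} {q : X → Fin m} (hq : Continuous q)
    (hs : Function.Surjective q) (hm : 1 ≤ m) :
    ∃ q' : X → Fin (m + 1), Continuous q' ∧ Function.Surjective q' ∧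
      ∃ h : Fin (m + 1) → Fin m, ∀ p, q p = h (q' p) := by
  classical
  obtain ⟨x, hx⟩ := hs ⟨0, hm⟩
  have hopen : IsOpen (q ⁻¹' {q x}) := (isOpen_discrete _).preimage hq
  have hne : (nhdsWithin x {x}ᶜ).NeBot := by
    simpa [AccPt] using PerfectSpace.univ_preperfect (α := X) x (Set.mem_univ x)
  obtain ⟨y, hy, hyx⟩ := Filter.nonempty_of_mem (f := nhdsWithin x {x}ᶜ)
    (Filter.inter_mem (mem_nhdsWithin_of_mem_nhds (hopen.mem_nhds rfl)) self_mem_nhdsWithin)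
  obtain ⟨U, hU, hxU, hUsub⟩ := compact_exists_isClopen_in_isOpen
    (hopen.inter (isOpen_compl_singleton (x := y))) ⟨rfl, fun h => hyx h.symm⟩
  refine ⟨fun p => if p ∈ U then Fin.last m else (q p).castSucc, ?_, ?_,
    Fin.lastCases (q x) id, ?_⟩
  · exact Continuous.if (fun a ha => by simp [hU.frontier_eq] at ha) continuous_const
      (continuous_of_discreteTopology.comp hq)
  · intro i
    refine Fin.lastCases ⟨x, if_pos hxU⟩ (fun j => ?_) i
    by_cases hj : j = q x
    · exact ⟨y, (if_neg fun h => (hUsub h).2 rfl).trans (by rw [hj, show q y = q x from hy])⟩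
    · obtain ⟨p, rfl⟩ := hs j
      exact ⟨p, if_neg fun h => hj (hUsub h).1⟩
  · intro p
    by_cases hp : p ∈ U
    · simp only [hp, if_true, Fin.lastCases_last]
      exact (hUsub hp).1
    · simp [hp]

/-- In a perfect profinite space a finite clopen partition has refinements of every larger
cardinality. -/
lemma exists_refinement {m m' : ℕ} {q : X → Fin m} (hq : Continuous q)
    (hs : Function.Surjective q) (hm : 1 ≤ m) (hmm' : m ≤ m') :
    ∃ q' : X → Fin m', Continuous q' ∧ Function.Surjective q' ∧
      Refines (fiberPartition q') (fiberPartition q) := by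
  induction m', hmm' using Nat.le_induction with
  | base => exact ⟨q, hq, hs, fun U hU => ⟨U, hU, subset_rfl⟩⟩
  | succ m' hle ih =>
    obtain ⟨q', hq', hs', hr⟩ := ih
    obtain ⟨q'', hq'', hs'', h⟩ := exists_refinement_succ hq' hs' (hm.trans hle)
    exact ⟨q'', hq'', hs'', (refines_fiberPartition_iff.2 h).trans hr⟩

end profinite

variable {X : Type*} [TopologicalSpace X] [CompactSpace X]

lemma omits_typeSet_unliftable_iff {S : X ≃ₜ X} {n m : ℕ} (hn : 1 ≤ n) (hm : f n < m) :
    Omits S (typeSet unliftable n m) ↔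
      ∀ (α : X → W n) (q : X → Fin m), IsSpiralMap S n α → Continuous q → Function.Surjective q →
        Refines (fiberPartition q) (fiberPartition α) →
        ∃ k, 1 ≤ k ∧ m < f (n + k) ∧ ∃ β : X → W (n + k), IsSpiralMap S (n + k) β ∧
          Refines (fiberPartition β) (fiberPartition q) ∧ α = xi n k ∘ β := by
  constructor
  · intro ho α q hα hq hs hr
    obtain ⟨x, hx⟩ := exists_isFiberProjections hα.continuous
    obtain ⟨y, hy⟩ := exists_isFiberProjections hq
    by_contra! hno
    refine ho ⟨Sum.elim x y, ?_⟩
    rintro _ ⟨k, hk, hmk, rfl⟩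
    refine holds_unliftable_iff.2 ⟨α, q, hα, hx, hq, hs, hy, hr, ?_⟩
    rintro ⟨β, hβ, hβq, hxi⟩
    exact hno k hk hmk β hβ hβq hxi
  · rintro h ⟨a, ha⟩
    have ha' : ∀ k, 1 ≤ k → m < f (n + k) → IsUnliftable S n m k (a ∘ Sum.inl) (a ∘ Sum.inr) :=
      fun k hk hmk => holds_unliftable_iff.1 (by
        rw [Sum.elim_comp_inl_inr]; exact ha _ ⟨k, hk, hmk, rfl⟩)
    -- The choice `k = m` is admissible since `m ≤ n + m < f (n + m)`; so the type is non-empty and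
    -- does yield some `α` and `q`.
    obtain ⟨α, q, hα, hx, hq, hs, hy, hr, -⟩ := ha' m (by omega)
      ((Nat.le_add_left m n).trans_lt (lt_f (by omega)))
    obtain ⟨k, hk, hmk, β, hβ, hβq, hxi⟩ := h α q hα hq hs hr
    obtain ⟨α', q', -, hx', -, -, hy', -, hno⟩ := ha' k hk hmk
    rw [← hx.unique hx', ← hy.unique hy'] at hno
    exact hno ⟨β, hβ, hβq, hxi⟩

/-- A partition refining `A_φ` may have exactly `f n` cells, while the types need more; and a lift
through `m` cells gives only `m ≤ f (n + k)`. In both directions one additional cell makes the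
inequality strict. -/
theorem omits_unliftable_iff_hasLiftingProperty [T2Space X] [TotallyDisconnectedSpace X]
    [PerfectSpace X] (S : X ≃ₜ X) :
    (∀ n m : ℕ, 1 ≤ n → f n < m → Omits S (typeSet unliftable n m)) ↔ HasLiftingProperty S := by
  constructor
  · intro ho n hn φ hφ A hA hr
    obtain ⟨N, q₀, hq₀, hs₀, hr₀⟩ := hA.exists_map
    have hfN : f n ≤ N := by
      have := card_le_of_refines hφ.surjective (hr₀.trans hr)
      rwa [card_W hn, Fintype.card_fin] at this
    have hlt := lt_f hn
    obtain ⟨q, hq, hs, hr'⟩ := exists_refinement hq₀ hs₀ (by omega) (Nat.le_succ N)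
    obtain ⟨k, hk, -, β, hβ, hβq, hxi⟩ := (omits_typeSet_unliftable_iff hn (by omega)).1
      (ho n (N + 1) hn (by omega)) φ q hφ hq hs (hr'.trans (hr₀.trans hr))
    exact ⟨k, hk, β, hβ, hβq.trans (hr'.trans hr₀), hxi⟩
  · intro hL n m hn hm
    rw [omits_typeSet_unliftable_iff hn hm]
    intro α q hα hq hs hr
    obtain ⟨q', hq', hs', hr'⟩ := exists_refinement hq hs (by omega) (Nat.le_succ m)
    obtain ⟨k, hk, β, hβ, hβq, hxi⟩ := hL n hn α hα _ (isClopenPartition_fiberPartition hq' hs')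
      (hr'.trans hr)
    refine ⟨k, hk, ?_, β, hβ, hβq.trans hr', hxi⟩
    have := card_le_of_refines hs' hβq
    rw [card_W (by omega), Fintype.card_fin] at this
    omega

/-! ### Small diameters versus clopen partitions -/

section metric

variable {X : Type*} [MetricSpace X] [CompactSpace X]

/-- The cover by balls of radius `ε / 3`, cut down to fibres of `φ`, has a finite disjoint clopen
refinement; its members have diameter at most `2 * ε / 3`. -/
lemma exists_clopenPartition_diam_lt [TotallyDisconnectedSpace X] {V : Type*} [TopologicalSpace V]
    [DiscreteTopology V] {φ : X → V} (hφ : Continuous φ) {ε : ℝ} (hε : 0 < ε) :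
    ∃ A, IsClopenPartition A ∧ Refines A (fiberPartition φ) ∧ ∀ U ∈ A, Metric.diam U < ε := by
  let c : X → TopologicalSpace.Opens X := fun x =>
    ⟨Metric.ball x (ε / 3) ∩ φ ⁻¹' {φ x}, Metric.isOpen_ball.inter ((isOpen_discrete _).preimage hφ)⟩
  have hc : TopologicalSpace.IsOpenCover c := by
    rw [TopologicalSpace.IsOpenCover, eq_top_iff]
    intro x _
    exact TopologicalSpace.Opens.mem_iSup.2 ⟨x, Metric.mem_ball_self (by positivity), rfl⟩
  obtain ⟨N, T, hT, hcov, hdisj⟩ := hc.exists_finite_nonempty_disjoint_clopen_cover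
  refine ⟨Set.range fun j => (T j : Set X), ⟨⟨?_, fun p => ?_⟩, ?_⟩, ?_, ?_⟩
  · rintro ⟨j, hj⟩
    exact (hT j).1 (SetLike.coe_injective hj)
  · obtain ⟨j, hj⟩ := Set.mem_iUnion.1 (hcov (Set.mem_univ p))
    refine ⟨_, ⟨⟨j, rfl⟩, hj⟩, ?_⟩
    rintro _ ⟨⟨i, rfl⟩, hi⟩
    by_contra hne
    have hij : i ≠ j := fun h => hne (by rw [h])
    have h1 := hdisj hij
    have h2 : ({p} : Set X) ⊆ ∅ := by
      have h3 : T i ⊓ T j = ⊥ := h1.eq_bot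
      have h4 : p ∈ ((T i ⊓ T j : TopologicalSpace.Clopens X) : Set X) := ⟨hi, hj⟩
      rw [h3] at h4
      exact absurd h4 (by simp)
    exact h2 rfl
  · rintro _ ⟨j, rfl⟩
    exact (T j).isClopen
  · rintro _ ⟨j, rfl⟩
    obtain ⟨x, hx⟩ := (hT j).2
    exact ⟨_, ⟨φ x, rfl⟩, fun p hp => (hx hp).2⟩
  · rintro _ ⟨j, rfl⟩
    obtain ⟨x, hx⟩ := (hT j).2
    have h1 : Metric.diam (T j : Set X) ≤ 2 * (ε / 3) :=
      (Metric.diam_mono (fun p hp => (hx hp).1) Metric.isBounded_ball).trans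
        (Metric.diam_ball (by positivity))
    exact h1.trans_lt (by linarith)

/-- Small clopen cells bound the diameters of the fibres of a lift. Conversely, fibres of diameter
below a Lebesgue number of the partition lie inside its cells. -/
theorem hasLiftingProperty_iff_hasMetricLiftingProperty [TotallyDisconnectedSpace X]
    (S : X ≃ₜ X) : HasLiftingProperty S ↔ HasMetricLiftingProperty S := by
  have hbdd : ∀ U : Set X, Bornology.IsBounded U := fun U =>
    isCompact_univ.isBounded.subset (Set.subset_univ U)
  constructor
  · intro h ε hε n hn φ hφ
    obtain ⟨A, hA, hr, hd⟩ := exists_clopenPartition_diam_lt hφ.continuous hε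
    obtain ⟨k, hk, ψ, hψ, hψA, hxi⟩ := h n hn φ hφ A hA hr
    refine ⟨k, hk, ψ, hψ, fun U hU => ?_, hxi⟩
    obtain ⟨V, hV, hUV⟩ := hψA U hU
    exact (Metric.diam_mono hUV (hbdd V)).trans_lt (hd V hV)
  · intro h n hn φ hφ A hA _
    obtain ⟨δ, hδ, hleb⟩ := lebesgue_number_lemma_of_metric_sUnion isCompact_univ
      (fun U hU => (hA.2 U hU).2) (fun p _ => by
        obtain ⟨U, ⟨hU, hp⟩, -⟩ := hA.1.2 p
        exact ⟨U, hU, hp⟩)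
    obtain ⟨k, hk, ψ, hψ, hψd, hxi⟩ := h δ hδ n hn φ hφ
    refine ⟨k, hk, ψ, hψ, ?_, hxi⟩
    rintro _ ⟨v, rfl⟩
    obtain ⟨x, hx⟩ := hψ.surjective v
    obtain ⟨U, hU, hball⟩ := hleb x (Set.mem_univ x)
    exact ⟨U, hU, fun p hp => hball
      ((Metric.dist_le_diam_of_mem (hbdd _) hp hx).trans_lt (hψd _ ⟨v, rfl⟩))⟩

end metric

/-! ## A system without lifts -/

/-- The bi-infinite path that starts on the left cycle of a spiral, passes through the segment and
ends on the right cycle. -/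
noncomputable def Spiral.path (n : ℕ) (i : ℤ) : Spiral n :=
  if h : i ∈ Set.Icc (-(n : ℤ) + 1) ((n : ℤ) - 1) then .m ⟨i, h⟩
  else if i < 0 then .l (i : ZMod n.factorial) else .r (i : ZMod n.factorial)

namespace Spiral

variable {n : ℕ}

lemma path_of_le (hn : 1 ≤ n) {i : ℤ} (hi : i ≤ -n) : path n i = .l (i : ZMod n.factorial) := by
  rw [path, dif_neg (by rw [Set.mem_Icc]; omega), if_pos (by omega)]

lemma path_of_ge (hn : 1 ≤ n) {i : ℤ} (hi : n ≤ i) : path n i = .r (i : ZMod n.factorial) := by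
  rw [path, dif_neg (by rw [Set.mem_Icc]; omega), if_neg (by omega)]

lemma path_of_mem {i : ℤ} (hi : i ∈ Set.Icc (-(n : ℤ) + 1) ((n : ℤ) - 1)) :
    path n i = .m ⟨i, hi⟩ := by
  rw [path, dif_pos hi]

lemma rel_path (hn : 1 ≤ n) (i : ℤ) : Rel n (path n i) (path n (i + 1)) := by
  rcases lt_trichotomy i (-n) with h | rfl | h
  · rw [path_of_le hn h.le, path_of_le hn (by omega), Int.cast_add, Int.cast_one]
    exact .left _
  · rw [path_of_le hn le_rfl, path_of_mem (by rw [Set.mem_Icc]; omega)]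
    exact .leave _ rfl
  rcases lt_trichotomy i (n - 1) with h' | rfl | h'
  · rw [path_of_mem (by rw [Set.mem_Icc]; omega), path_of_mem (by rw [Set.mem_Icc]; omega)]
    exact .mid _ _ rfl
  · rw [path_of_mem (by rw [Set.mem_Icc]; omega), path_of_ge hn (by omega), sub_add_cancel]
    exact .enter _ rfl
  · rw [path_of_ge hn (by omega), path_of_ge hn (by omega), Int.cast_add, Int.cast_one]
    exact .right _

lemma path_surjective (hn : 1 ≤ n) : Function.Surjective (path n) := by
  have hfac : (1 : ℤ) ≤ n.factorial := by exact_mod_cast n.factorial_pos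
  rintro (k | k | k)
  · have hk : (k.val : ℤ) < n.factorial := by exact_mod_cast ZMod.val_lt k
    -- A multiple of `n!` is subtracted to reach the range `≤ -n` without changing the residue.
    refine ⟨k.val - (n + 1) * n.factorial, ?_⟩
    rw [path_of_le hn (by nlinarith)]
    simp
  · exact ⟨k.1, path_of_mem k.2⟩
  · refine ⟨k.val + n * n.factorial, ?_⟩
    rw [path_of_ge hn (by nlinarith)]
    simp

end Spiral

/-- The bi-infinite paths in `W n` whose points are labelled by truth values. -/
abbrev PathSpace (n : ℕ) : Type :=
  {s : ℤ → W n × Bool // ∀ i, W.Rel n (s i).1 (s (i + 1)).1}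

namespace PathSpace

variable {n : ℕ}

instance : CompactSpace (PathSpace n) := by
  refine isCompact_iff_compactSpace.1 (IsClosed.isCompact ?_)
  have : {s : ℤ → W n × Bool | ∀ i, W.Rel n (s i).1 (s (i + 1)).1} =
      ⋂ i, (fun s => (s i, s (i + 1))) ⁻¹' {a | W.Rel n a.1.1 a.2.1} := by
    ext s
    simp
  change IsClosed {s : ℤ → W n × Bool | _}
  rw [this]
  exact isClosed_iInter fun i => (isClosed_discrete _).preimage (by fun_prop)

lemma exists_window {U : Set (PathSpace n)} (hU : IsOpen U) {s : PathSpace n} (hs : s ∈ U) :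
    ∃ N : ℕ, ∀ t : PathSpace n, (∀ i : ℤ, |i| ≤ N → t.1 i = s.1 i) → t ∈ U := by
  obtain ⟨O, hO, rfl⟩ := isOpen_induced_iff.1 hU
  obtain ⟨I, u, hu, hsub⟩ := isOpen_pi_iff.1 hO s.1 hs
  refine ⟨I.sup Int.natAbs, fun t ht => hsub fun i hi => ?_⟩
  rw [ht i]
  · exact (hu i hi).2
  · rw [Int.abs_eq_natAbs]
    exact_mod_cast Finset.le_sup (f := Int.natAbs) hi

/-- Flipping the bits outside a window gives a different nearby point. Without bits, for `n ≥ 1`, a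
path through the segment would be isolated, as one position on the segment determines all others. -/
instance : PerfectSpace (PathSpace n) := by
  refine ⟨fun s _ => accPt_iff_nhds.2 fun U hU => ?_⟩
  obtain ⟨O, hOU, hO, hs⟩ := mem_nhds_iff.1 hU
  obtain ⟨N, hN⟩ := exists_window hO hs
  let t : PathSpace n := ⟨fun i => ((s.1 i).1, if |i| ≤ N then (s.1 i).2 else !(s.1 i).2),
    fun i => s.2 i⟩
  refine ⟨t, ⟨hOU (hN t fun i hi => ?_), Set.mem_univ _⟩, fun h => ?_⟩
  · simp [t, hi]
  · have h1 := congrArg (fun r : PathSpace n => (r.1 (N + 1)).2) h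
    have h2 : ¬ |(N : ℤ) + 1| ≤ N := by rw [abs_of_nonneg (by positivity)]; omega
    simp [t, h2] at h1

/-- The shift. -/
def shift (n : ℕ) : PathSpace n ≃ₜ PathSpace n where
  toFun s := ⟨fun i => s.1 (i + 1), fun i => s.2 (i + 1)⟩
  invFun s := ⟨fun i => s.1 (i - 1), fun i => by
    have := s.2 (i - 1)
    rwa [sub_add_eq_add_sub] at this⟩
  left_inv s := by ext1; funext i; simp
  right_inv s := by ext1; funext i; simp
  continuous_toFun := by
    refine Continuous.subtype_mk (continuous_pi fun i => ?_) _
    exact (continuous_apply (i + 1)).comp continuous_subtype_val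
  continuous_invFun := by
    refine Continuous.subtype_mk (continuous_pi fun i => ?_) _
    exact (continuous_apply (i - 1)).comp continuous_subtype_val

/-- A path moved `T` places to the right. -/
def delay (T : ℕ) (s : PathSpace n) : PathSpace n :=
  ⟨fun i => s.1 (i - T), fun i => by
    have := s.2 (i - T)
    rwa [sub_add_eq_add_sub] at this⟩

lemma apply_delay {D : Type*} {g : PathSpace n → D} (hg : ∀ s, g (shift n s) = g s) (T : ℕ)
    (s : PathSpace n) : g (delay T s) = g s := by
  induction T with
  | zero => congr 1; ext1; funext i; simp [delay]
  | succ T ih =>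
    rw [← ih, ← hg]
    congr 1
    ext1
    funext i
    simp only [shift, delay, Homeomorph.homeomorph_mk_coe, Equiv.coe_fn_mk]
    exact congrArg s.1 (by push_cast; ring)

/-- The path that runs around the left cycle of the spiral with a given word. -/
def leftCycle (w : Fin n → Letter) : PathSpace n :=
  ⟨fun i => (⟨w, .l i⟩, false), fun i => ⟨rfl, by push_cast; exact .left _⟩⟩

/-- The initial point of a path, as a map onto `W n`. -/
def start (s : PathSpace n) : W n := (s.1 0).1

lemma isSpiralMap_start (hn : 1 ≤ n) : IsSpiralMap (shift n) n (start (n := n)) where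
  continuous := continuous_fst.comp ((continuous_apply (0 : ℤ)).comp continuous_subtype_val)
  surjective := by
    rintro ⟨w, v⟩
    obtain ⟨K, rfl⟩ := Spiral.path_surjective hn v
    refine ⟨⟨fun i => (⟨w, Spiral.path n (K + i)⟩, false), fun i => ⟨rfl, ?_⟩⟩, ?_⟩
    · dsimp only
      rw [← add_assoc]
      exact Spiral.rel_path hn _
    · simp [start]
  rel s := s.2 0

/-- A shift-invariant map that depends locally on finitely many places takes each of its values
on a path around a left cycle. -/
lemma exists_apply_leftCycle (hn : 1 ≤ n) {D : Type*} {g : PathSpace n → D}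
    (hg : ∀ s, g (shift n s) = g s) (hopen : ∀ s, IsOpen {t | g t = g s}) (s : PathSpace n) :
    ∃ w, g s = g (leftCycle w) := by
  obtain ⟨N, hN⟩ := exists_window (hopen s) (s := s) rfl
  obtain ⟨K, hK⟩ := Spiral.path_surjective hn (s.1 (-N)).1.pt
  set w := (s.1 (-N)).1.word with hw
  -- Every vertex can be reached from the left cycle. Keeping `s` from `-N` on, its past is replaced
  -- by such an approach; `g` sees only the window and does not change.
  let t : PathSpace n :=
    ⟨fun i => if i < -N then (⟨w, Spiral.path n (K + N + i)⟩, false) else s.1 i, fun i => by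
      by_cases h1 : i + 1 < -N
      · simp only [h1, show i < -N by omega, if_true]
        refine ⟨rfl, ?_⟩
        rw [← add_assoc]
        exact Spiral.rel_path hn _
      · by_cases h2 : i < -N
        · obtain rfl : i = -N - 1 := by omega
          simp only [sub_add_cancel, lt_irrefl, if_false, h2, if_true]
          refine ⟨hw, ?_⟩
          rw [← hK]
          convert Spiral.rel_path hn (K - 1) using 2 <;> ring
        · simp only [h1, h2, if_false]
          exact s.2 i⟩
  have ht : g t = g s := hN t fun i hi => if_neg (by have := abs_le.1 hi; omega)
  obtain ⟨M, hM⟩ := exists_window (hopen (leftCycle w)) (s := leftCycle w) rfl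
  have hfac : (1 : ℤ) ≤ n.factorial := by exact_mod_cast n.factorial_pos
  -- `J` is so large that a delay by `T = K + N + J * n!` moves the left-cycle part of `t` over the
  -- whole window `[-M, M]`; the multiple of `n!` puts it in phase with `leftCycle w`.
  set J : ℤ := |K| + M + N + n + 1 with hJ
  have hKabs := neg_abs_le K
  have hKnonneg := abs_nonneg K
  have hJle : J ≤ J * n.factorial := le_mul_of_one_le_right (by positivity) hfac
  obtain ⟨T, hT⟩ := Int.eq_ofNat_of_zero_le (a := K + N + J * n.factorial) (by omega)
  refine ⟨w, ?_⟩
  rw [← ht, ← apply_delay hg T t]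
  refine hM _ fun i hi => ?_
  have hi' := abs_le.1 hi
  have hlt : i - (T : ℤ) < -N := by omega
  have hidx : K + N + (i - T) = i - J * n.factorial := by omega
  simp only [delay, t, hlt, if_true, leftCycle]
  rw [hidx, Spiral.path_of_le hn (by omega)]
  simp

/-- Words are constant along the relation, so the word of `β s` is shift-invariant and locally
constant. All its values occur on the `6 ^ n` left cycles, fewer than the `6 ^ (n + k)` required by
surjectivity. -/
lemma not_exists_isSpiralMap (hn : 1 ≤ n) {k : ℕ} (hk : 1 ≤ k) :
    ¬ ∃ β, IsSpiralMap (shift n) (n + k) β := by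
  rintro ⟨β, hβ⟩
  have hsurj : Function.Surjective fun w : Fin n → Letter => (β (leftCycle w)).word := by
    intro u
    obtain ⟨s, hs⟩ := hβ.surjective ⟨u, .l 0⟩
    obtain ⟨w, hw⟩ := exists_apply_leftCycle hn (g := fun s => (β s).word)
      (fun s => (hβ.rel s).1.symm)
      (fun s => (isOpen_discrete {x : W (n + k) | x.word = (β s).word}).preimage hβ.continuous) s
    exact ⟨w, hw.symm.trans (by rw [hs])⟩
  have := Fintype.card_le_of_surjective _ hsurj
  rw [card_words, card_words] at this
  exact absurd this (not_le.2 (Nat.pow_lt_pow_right (by norm_num) (by omega)))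

end PathSpace

/-- As the path space has no map onto any `W (n + k)` with `k ≥ 1`, any refinement of the partition
by initial points into `m` cells satisfies all the conditions at once. -/
theorem isTypeOfCantorA_typeSet_unliftable {n m : ℕ} (hn : 1 ≤ n) (hm : f n < m) :
    IsTypeOfCantorA (typeSet unliftable n m) := by
  have hα := PathSpace.isSpiralMap_start hn
  have hcard := card_W hn
  have hlt := lt_f hn
  let e := Fintype.equivFin (W n)
  obtain ⟨q, hq, hs, hr⟩ := exists_refinement (q := e ∘ PathSpace.start)
    (continuous_of_discreteTopology.comp hα.continuous) (e.surjective.comp hα.surjective)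
    (by omega) (hcard.trans_le hm.le)
  obtain ⟨x, hx⟩ := exists_isFiberProjections hα.continuous
  obtain ⟨y, hy⟩ := exists_isFiberProjections hq
  refine ⟨PathSpace n, inferInstance, inferInstance, inferInstance, inferInstance, inferInstance,
    PathSpace.shift n, Sum.elim x y, ?_⟩
  rintro _ ⟨k, hk, -, rfl⟩
  refine holds_unliftable_iff.2 ⟨_, q, hα, hx, hq, hs, hy, hr.trans ?_, ?_⟩
  · exact refines_fiberPartition_iff.2 ⟨e.symm, fun p => by simp⟩
  · rintro ⟨β, hβ, -⟩
    exact PathSpace.not_exists_isSpiralMap hn hk ⟨β, hβ⟩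

end CantorLifting

open CantorLifting in
theorem theorem3p5 :
    ∃ ψ : (n m k : ℕ) → Formula (W n ⊕ Fin m),
      -- each `ψ_{n,m,k}` expresses the intended property of tuples of projections
      (∀ n m k : ℕ, 1 ≤ n → f n < m → 1 ≤ k → m < f (n + k) →
        ∀ (X : Type*) [TopologicalSpace X] [CompactSpace X] [T2Space X]
          [TotallyDisconnectedSpace X] [PerfectSpace X] (S : X ≃ₜ X)
          (x : W n → C(X, ℂ)) (y : Fin m → C(X, ℂ)),
          Formula.Holds (dualAut S) (ψ n m k) (Sum.elim x y) ↔ IsUnliftable S n m k x y) ∧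
      -- each `Σ_{n,m}` is a type
      (∀ n m : ℕ, 1 ≤ n → f n < m → IsTypeOfCantorA (typeSet ψ n m)) ∧
      -- a model omits all the types if and only if it has the lifting property
      (∀ (X : Type*) [TopologicalSpace X] [CompactSpace X] [T2Space X]
        [TotallyDisconnectedSpace X] [PerfectSpace X] (S : X ≃ₜ X),
        (∀ n m : ℕ, 1 ≤ n → f n < m → Omits S (typeSet ψ n m)) ↔ HasLiftingProperty S) ∧
      -- the same for the metric form of the lifting property
      (∀ (X : Type*) [MetricSpace X] [CompactSpace X]
        [TotallyDisconnectedSpace X] [PerfectSpace X] (S : X ≃ₜ X),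
        (∀ n m : ℕ, 1 ≤ n → f n < m → Omits S (typeSet ψ n m)) ↔
          HasMetricLiftingProperty S) := by
  refine ⟨unliftable, ?_, ?_, ?_, ?_⟩
  · intro n m k _ _ _ _ X _ _ _ _ _ S x y
    exact holds_unliftable_iff
  · exact fun n m hn hm => isTypeOfCantorA_typeSet_unliftable hn hm
  · intro X _ _ _ _ _ S
    exact omits_unliftable_iff_hasLiftingProperty S
  · intro X _ _ _ _ S
    exact (omits_unliftable_iff_hasLiftingProperty S).trans
      (hasLiftingProperty_iff_hasMetricLiftingProperty S)
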